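/- Conventions. A modulus is a continuous, non-decreasing, subadditive function $\Delta\colon[0,\infty)\to[0,\infty)$ with $\Delta(0)=0$; a map $f$ between metric spaces obeys $\Delta$ if $d(f(x),f(y))\le\Delta(d(x,y))$ for all $x,y$. A metric signature $\sigma$ is a (possibly infinite or uncountable) collection of predicate, function and constant symbols, where each predicate or function symbol $s$ is assigned an arity in $\mathbb N$ and a modulus $\Delta_s$. A $\sigma$-structure $\mathfrak A$ is a complete metric space $(A,d)$ of diameter at most $1$ with, for each $n$-ary predicate symbol $P$, a function $P^{\mathfrak A}\colon A^n\to[0,1]$ obeying $\Delta_P$; for each $n$-ary function symbol $f$, a function $f^{\mathfrak A}\colon A^n\to A$ obeying $\Delta_f$ ($A^n$ carries the maximum metric); and for each constant symbol $c$, an element $c^{\mathfrak A}\in A$. Formulas of continuous first-order logic are built from the atomic formulas $d(t,t')$ and $P(t_0,\dots,t_{n-1})$, with $t,t',t_i$ being $\sigma$-terms, by arbitrary continuous connectives $[0,1]^m\to[0,1]$, $m\in\mathbb N$, and by the quantifiers $\inf_x$ and $\sup_x$. They are interpreted in the usual way as $[0,1]$-valued functions, with $\inf$ and $\sup$ ranging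 over $A$ and taken in $[0,1]$. In particular each sentence $\varphi$ has a value $\varphi^{\mathfrak A}\in[0,1]$. The theory $\mathrm{Th}(\mathfrak A)$ is the set of all sentences $\varphi$ with $\varphi^{\mathfrak A}=0$, and $\mathfrak B\models T$ means that $\varphi^{\mathfrak B}=0$ for all $\varphi\in T$. An isomorphism of $\sigma$-structures is a surjective isometry that preserves the interpretations of all symbols of $\sigma$. A theory is categorical if it has a model and any two of its models are isomorphic. Theorem. Let $\sigma$ be a metric signature and let $\mathfrak A$ be a $\sigma$-structure whose underlying metric space is compact. Then $\mathrm{Th}(\mathfrak A)$ is categorical; that is, every $\sigma$-structure $\mathfrak B$ with $\mathfrak B\models\mathrm{Th}(\mathfrak A)$ is isomorphic to $\mathfrak A$. -/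

import Mathlib

open scoped NNReal

universe u v w x y

namespace ContLogic

/-- A modulus of uniform continuity: a continuous, non-decreasing, subadditive function
`[0, ∞) → [0, ∞)` that vanishes at zero. -/
structure Modulus where
  toFun : ℝ≥0 → ℝ≥0
  map_zero : toFun 0 = 0
  mono : Monotone toFun
  subadd : ∀ r s, toFun (r + s) ≤ toFun r + toFun s
  cont : Continuous toFun

/-- `f` obeys the modulus `Δ`. Finite powers `Fin n → A` carry the maximum metric. -/
def Obeys {X : Type*} {Y : Type*} [MetricSpace X] [MetricSpace Y] (f : X → Y) (Δ : Modulus) :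
    Prop :=
  ∀ a b, nndist (f a) (f b) ≤ Δ.toFun (nndist a b)

/-- A metric signature of arbitrary size: predicate and function symbols with arities and moduli,
and constant symbols. All structures have diameter at most `1`, and all predicates take values in
`[0, 1]`. -/
structure Signature : Type (max (u + 1) (v + 1) (w + 1)) where
  Pred : Type u
  Func : Type v
  Const : Type w
  predArity : Pred → ℕ
  funcArity : Func → ℕ
  predModulus : Pred → Modulus
  funcModulus : Func → Modulus

/-- A structure for the signature `σ`: a complete metric space of diameter at most `1` with
interpretations of the symbols that obey the moduli given by `σ`. -/
structure MetricStructure (σ : Signature.{u, v, w}) where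
  carrier : Type x
  [metric : MetricSpace carrier]
  [complete : CompleteSpace carrier]
  dist_le_one : ∀ a b : carrier, dist a b ≤ 1
  pred : ∀ P : σ.Pred, (Fin (σ.predArity P) → carrier) → unitInterval
  pred_obeys : ∀ P, Obeys (pred P) (σ.predModulus P)
  func : ∀ f : σ.Func, (Fin (σ.funcArity f) → carrier) → carrier
  func_obeys : ∀ f, Obeys (func f) (σ.funcModulus f)
  const : σ.Const → carrier

attribute [instance] MetricStructure.metric MetricStructure.complete

/-- Terms with variables among `v₀, …, vₙ₋₁`. -/
inductive Term (σ : Signature.{u, v, w}) (n : ℕ) : Type (max v w)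
  | var (i : Fin n) : Term σ n
  | const (c : σ.Const) : Term σ n
  | app (f : σ.Func) (t : Fin (σ.funcArity f) → Term σ n) : Term σ n

/-- Formulas of continuous first-order logic with free variables among `v₀, …, vₙ₋₁`. Connectives
are all continuous functions `[0, 1]ᵐ → [0, 1]`, for all `m`; the quantifiers `inf` and `sup`
bind the variable `vₙ`. -/
inductive Formula (σ : Signature.{u, v, w}) : ℕ → Type (max u v w)
  | dist {n : ℕ} (t t' : Term σ n) : Formula σ n
  | pred {n : ℕ} (P : σ.Pred) (t : Fin (σ.predArity P) → Term σ n) : Formula σ n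
  | conn {n m : ℕ} (c : C(Fin m → unitInterval, unitInterval)) (φ : Fin m → Formula σ n) : Formula σ n
  | inf {n : ℕ} (φ : Formula σ (n + 1)) : Formula σ n
  | sup {n : ℕ} (φ : Formula σ (n + 1)) : Formula σ n

/-- A sentence is a formula without free variables. -/
abbrev Sentence (σ : Signature.{u, v, w}) := Formula σ 0

/-- The interpretation of a term as a function `Aⁿ → A`. -/
def Term.eval {σ : Signature.{u, v, w}} (A : MetricStructure.{u, v, w, x} σ) {n : ℕ} :
    Term σ n → (Fin n → A.carrier) → A.carrier
  | .var i, a => a i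
  | .const c, _ => A.const c
  | .app f t, a => A.func f fun i => (t i).eval A a

/-- The interpretation of a formula as a function `Aⁿ → [0, 1]`. -/
noncomputable def Formula.eval {σ : Signature.{u, v, w}} (A : MetricStructure.{u, v, w, x} σ) :
    {n : ℕ} → Formula σ n → (Fin n → A.carrier) → unitInterval
  | _, .dist t t', a =>
      ⟨Dist.dist (t.eval A a) (t'.eval A a), dist_nonneg, A.dist_le_one _ _⟩
  | _, .pred P t, a => A.pred P fun i => (t i).eval A a
  | _, .conn c φ, a => c fun i => (φ i).eval A a
  | _, .inf φ, a => ⨅ b : A.carrier, φ.eval A (Fin.snoc a b)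
  | _, .sup φ, a => ⨆ b : A.carrier, φ.eval A (Fin.snoc a b)

/-- The value of a sentence in a structure. -/
noncomputable def Sentence.value {σ : Signature.{u, v, w}} (φ : Sentence σ)
    (A : MetricStructure.{u, v, w, x} σ) : unitInterval :=
  Formula.eval A φ Fin.elim0

/-- A theory is a set of sentences `φ`, each standing for the condition `φ = 0`. -/
abbrev Theory (σ : Signature.{u, v, w}) := Set (Sentence σ)

/-- `A ⊨ T`. -/
def MetricStructure.Models {σ : Signature.{u, v, w}} (A : MetricStructure.{u, v, w, x} σ)
    (T : Theory σ) : Prop :=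
  ∀ φ ∈ T, φ.value A = 0

/-- `Th(A)`: all conditions `φ = 0`, with `φ` a sentence, that are true in `A`. -/
def MetricStructure.theory {σ : Signature.{u, v, w}} (A : MetricStructure.{u, v, w, x} σ) :
    Theory σ :=
  {φ | φ.value A = 0}

/-- An isomorphism: a surjective isometry that preserves all symbols of the signature. -/
structure Iso {σ : Signature.{u, v, w}} (A : MetricStructure.{u, v, w, x} σ)
    (B : MetricStructure.{u, v, w, y} σ) where
  toIsometryEquiv : A.carrier ≃ᵢ B.carrier
  map_pred : ∀ (P : σ.Pred) (a : Fin (σ.predArity P) → A.carrier),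
    B.pred P (fun i => toIsometryEquiv (a i)) = A.pred P a
  map_func : ∀ (f : σ.Func) (a : Fin (σ.funcArity f) → A.carrier),
    B.func f (fun i => toIsometryEquiv (a i)) = toIsometryEquiv (A.func f a)
  map_const : ∀ c : σ.Const, B.const c = toIsometryEquiv (A.const c)

/-- A theory is categorical (with respect to structures on types in the universe `x`) if it has
a unique model up to isomorphism. -/
def Theory.IsCategorical {σ : Signature.{u, v, w}} (T : Theory σ) : Prop :=
  (∃ A : MetricStructure.{u, v, w, x} σ, A.Models T) ∧
    ∀ A B : MetricStructure.{u, v, w, x} σ, A.Models T → B.Models T → Nonempty (Iso A B)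

end ContLogic

namespace ContLogic

/-! Since `|φ - r|` is a formula, a model B of Th(A) gives every sentence the value it has in A. For
each r > 0 some `covering σ n` has infimum at most r in A, hence in B, so B is totally bounded and,
being complete, compact (`compactSpace_of_models`). Infima over B are then attained, so a formula
that vanishes at a tuple of A vanishes at a tuple of B (`Formula.exists_eval_eq_zero`). By
Tychonoff, `A → B` is compact. The maps that preserve one vanishing formula form a closed nonempty
set, and these sets are directed; a common element f preserves the values of all formulas
(`exists_elementary_map`). Such an f is an isometry, respects the symbols, and has dense image
because it preserves `covering`; the image is also closed, so f is onto. -/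

variable {σ : Signature.{u, v, w}}

/-! ### Renaming of variables -/

/-- Renaming of the variables of a term. -/
def Term.relabel {n m : ℕ} (g : Fin n → Fin m) : Term σ n → Term σ m
  | .var i => .var (g i)
  | .const c => .const c
  | .app f t => .app f fun i => (t i).relabel g

/-- Renaming of the free variables of a formula. -/
def Formula.relabel : {n : ℕ} → Formula σ n → {m : ℕ} → (Fin n → Fin m) → Formula σ m
  | _, .dist t t', _, g => .dist (t.relabel g) (t'.relabel g)
  | _, .pred P t, _, g => .pred P fun i => (t i).relabel g
  | _, .conn c φ, _, g => .conn c fun i => (φ i).relabel g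
  | _, .inf φ, _, g => .inf (φ.relabel (Fin.snoc (fun i => (g i).castSucc) (Fin.last _)))
  | _, .sup φ, _, g => .sup (φ.relabel (Fin.snoc (fun i => (g i).castSucc) (Fin.last _)))

theorem Term.eval_relabel (A : MetricStructure.{u, v, w, x} σ) {n m : ℕ} (g : Fin n → Fin m)
    (t : Term σ n) (a : Fin m → A.carrier) :
    (t.relabel g).eval A a = t.eval A (a ∘ g) := by
  induction t with
  | var i => rfl
  | const c => rfl
  | app f t ih => simp only [Term.relabel, Term.eval, ih]

theorem snoc_comp_lift {X : Type*} {n m : ℕ} (g : Fin n → Fin m) (a : Fin m → X) (b : X) :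
    (Fin.snoc a b : Fin (m + 1) → X) ∘
        (Fin.snoc (fun i => (g i).castSucc) (Fin.last m) : Fin (n + 1) → Fin (m + 1)) =
      (Fin.snoc (a ∘ g) b : Fin (n + 1) → X) := by
  ext i
  refine Fin.lastCases ?_ (fun j => ?_) i <;> simp

theorem Formula.eval_relabel (A : MetricStructure.{u, v, w, x} σ) {n : ℕ} (φ : Formula σ n) :
    ∀ {m : ℕ} (g : Fin n → Fin m) (a : Fin m → A.carrier),
      (φ.relabel g).eval A a = φ.eval A (a ∘ g) := by
  induction φ with
  | dist t t' => intro m g a; simp only [Formula.relabel, Formula.eval, Term.eval_relabel]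
  | pred P t => intro m g a; simp only [Formula.relabel, Formula.eval, Term.eval_relabel]
  | conn c φ ih => intro m g a; simp only [Formula.relabel, Formula.eval, ih]
  | inf φ ih => intro m g a; simp only [Formula.relabel, Formula.eval, ih, snoc_comp_lift]
  | sup φ ih => intro m g a; simp only [Formula.relabel, Formula.eval, ih, snoc_comp_lift]

/-! ### Infima over tuples and auxiliary formulas -/

/-- The sentence `inf_{v₀} ⋯ inf_{vₙ₋₁} φ`. -/
def Formula.infClosure : {n : ℕ} → Formula σ n → Sentence σ
  | 0, φ => φ
  | _ + 1, φ => φ.inf.infClosure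

theorem Formula.infClosure_value_le (A : MetricStructure.{u, v, w, x} σ) {n : ℕ}
    (φ : Formula σ n) (a : Fin n → A.carrier) : φ.infClosure.value A ≤ φ.eval A a := by
  induction n with
  | zero => exact le_of_eq (congrArg (φ.eval A) (Subsingleton.elim _ _))
  | succ n ih =>
    refine (ih φ.inf (Fin.init a)).trans ((iInf_le _ (a (Fin.last n))).trans ?_)
    rw [Fin.snoc_init_self]

/-- Infima need not be attained, so the bound is strict. An infimum over an empty structure is `1`,
so the bound also guarantees that a tuple exists. -/
theorem Formula.exists_eval_lt (A : MetricStructure.{u, v, w, x} σ) {n : ℕ}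
    (φ : Formula σ n) {r : unitInterval} (h : φ.infClosure.value A < r) :
    ∃ a, φ.eval A a < r := by
  induction n with
  | zero => exact ⟨_, h⟩
  | succ n ih =>
    obtain ⟨a, ha⟩ := ih φ.inf h
    obtain ⟨b, hb⟩ := iInf_lt_iff.1 ha
    exact ⟨_, hb⟩

/-- The connective `s ↦ |s - r|`. -/
def distConn (r : unitInterval) : C(Fin 1 → unitInterval, unitInterval) where
  toFun s := ⟨dist (s 0) r, dist_nonneg, by
    exact (Real.dist_le_of_mem_Icc (s 0).2 r.2).trans (sub_zero _).le⟩
  continuous_toFun := by fun_prop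

/-- The formula `|φ - r|`. -/
def Formula.distTo {n : ℕ} (φ : Formula σ n) (r : unitInterval) : Formula σ n :=
  .conn (distConn r) fun _ => φ

theorem Formula.eval_distTo_eq_zero (A : MetricStructure.{u, v, w, x} σ) {n : ℕ}
    (φ : Formula σ n) (r : unitInterval) (a : Fin n → A.carrier) :
    (φ.distTo r).eval A a = 0 ↔ φ.eval A a = r := by
  rw [← dist_eq_zero (x := φ.eval A a), Subtype.ext_iff]
  rfl

/-- The formula `max φ ψ`. -/
def Formula.max {n : ℕ} (φ ψ : Formula σ n) : Formula σ n :=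
  .conn ⟨fun s => s 0 ⊔ s 1, by fun_prop⟩ ![φ, ψ]

theorem Formula.eval_max (A : MetricStructure.{u, v, w, x} σ) {n : ℕ}
    (φ ψ : Formula σ n) (a : Fin n → A.carrier) :
    (φ.max ψ).eval A a = φ.eval A a ⊔ ψ.eval A a := rfl

/-- The formula `sup_y min_{i < n} d(vᵢ, y)`. -/
def covering (σ : Signature.{u, v, w}) (n : ℕ) : Formula σ n :=
  .sup (.conn ⟨fun s : Fin n → unitInterval => Finset.univ.inf s,
      Continuous.finset_inf_apply fun i _ => continuous_apply i⟩
    fun i => .dist (.var i.castSucc) (.var (Fin.last n)))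

/-- The hypothesis `r < 1` serves `n = 0`, where the minimum is the empty one, `1`. -/
theorem eval_covering_le_iff (A : MetricStructure.{u, v, w, x} σ) {n : ℕ}
    (a : Fin n → A.carrier) {r : unitInterval} (hr : r < 1) :
    (covering σ n).eval A a ≤ r ↔ ∀ b, ∃ i, dist (a i) b ≤ r := by
  refine iSup_le_iff.trans (forall_congr' fun b => ?_)
  refine (Finset.inf_le_iff hr).trans ?_
  simp [Formula.eval, Term.eval, ← Subtype.coe_le_coe]

/-! ### Transfer of compactness -/

theorem Sentence.value_eq_of_models {A : MetricStructure.{u, v, w, x} σ}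
    {B : MetricStructure.{u, v, w, y} σ} (h : B.Models A.theory) (φ : Sentence σ) :
    φ.value B = φ.value A :=
  (Formula.eval_distTo_eq_zero B φ _ _).1
    (h (φ.distTo (φ.value A)) ((Formula.eval_distTo_eq_zero A φ _ _).2 rfl))

theorem MetricStructure.exists_eval_covering_le (A : MetricStructure.{u, v, w, x} σ)
    [CompactSpace A.carrier] {r : unitInterval} (hr : 0 < r) (hr' : r < 1) :
    ∃ (n : ℕ) (a : Fin n → A.carrier), (covering σ n).eval A a ≤ r := by
  obtain ⟨t, ht, hcov⟩ := Metric.totallyBounded_iff.1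
    (isCompact_univ (X := A.carrier)).totallyBounded r hr
  have := ht.fintype
  refine ⟨_, fun i => ((Fintype.equivFin t).symm i : A.carrier),
    (eval_covering_le_iff A _ hr').2 fun b => ?_⟩
  obtain ⟨y, hy, hb⟩ := Set.mem_iUnion₂.1 (hcov (Set.mem_univ b))
  refine ⟨Fintype.equivFin t ⟨y, hy⟩, ?_⟩
  rw [Equiv.symm_apply_apply, dist_comm]
  exact (Metric.mem_ball.1 hb).le

theorem exists_unitInterval_lt {ε : ℝ} (hε : 0 < ε) :
    ∃ r : unitInterval, 0 < r ∧ r < 1 ∧ (r : ℝ) < ε := by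
  obtain ⟨r, hr, hr'⟩ := exists_between (lt_min hε one_pos)
  obtain ⟨h1, h2⟩ := lt_min_iff.1 hr'
  exact ⟨⟨r, hr.le, h2.le⟩, hr, h2, h1⟩

theorem MetricStructure.compactSpace_of_models {A : MetricStructure.{u, v, w, x} σ}
    [CompactSpace A.carrier] {B : MetricStructure.{u, v, w, y} σ} (h : B.Models A.theory) :
    CompactSpace B.carrier := by
  refine ⟨isCompact_iff_totallyBounded_isComplete.2
    ⟨Metric.totallyBounded_iff.2 fun ε hε => ?_, completeSpace_iff_isComplete_univ.1 B.complete⟩⟩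
  -- Two radii `r < s < ε`: centres in `B` are only found with a strict loss, and the balls are
  -- open.
  obtain ⟨s, hs, hs1, hsε⟩ := exists_unitInterval_lt hε
  obtain ⟨r, hr, hr1, hrs⟩ := exists_unitInterval_lt (ε := s) hs
  obtain ⟨n, a, ha⟩ := A.exists_eval_covering_le hr hr1
  have hB : (covering σ n).infClosure.value B < s := by
    rw [Sentence.value_eq_of_models h]
    exact ((Formula.infClosure_value_le A _ a).trans ha).trans_lt hrs
  obtain ⟨b, hb⟩ := Formula.exists_eval_lt B _ hB
  refine ⟨Set.range b, Set.finite_range b, fun y _ => ?_⟩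
  obtain ⟨i, hi⟩ := (eval_covering_le_iff B b hs1).1 hb.le y
  refine Set.mem_iUnion₂.2 ⟨b i, Set.mem_range_self i, ?_⟩
  rw [Metric.mem_ball, dist_comm]
  exact hi.trans_lt hsε

/-! ### Continuity and attained infima -/

theorem Obeys.continuous {X Y : Type*} [MetricSpace X] [MetricSpace Y] {f : X → Y} {Δ : Modulus}
    (h : Obeys f Δ) : Continuous f := by
  refine continuous_iff_continuousAt.2 fun a => tendsto_iff_dist_tendsto_zero.2 ?_
  have hc : Continuous fun b => (Δ.toFun (nndist b a) : ℝ) :=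
    NNReal.continuous_coe.comp (Δ.cont.comp (by fun_prop))
  have hΔ := hc.tendsto a
  rw [nndist_self, Δ.map_zero] at hΔ
  exact squeeze_zero (fun _ => dist_nonneg) (fun b => h b a) hΔ

theorem Term.continuous_eval (A : MetricStructure.{u, v, w, x} σ) {n : ℕ} (t : Term σ n) :
    Continuous (t.eval A) := by
  induction t with
  | var i => exact continuous_apply i
  | const c => exact continuous_const
  | app f t ih => exact (A.func_obeys f).continuous.comp (continuous_pi ih)

/-- Over a compact space, `inf` and `sup` of a jointly continuous function are continuous in the
parameters, so no moduli need to be computed for formulas. -/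
theorem Formula.continuous_eval (A : MetricStructure.{u, v, w, x} σ) [CompactSpace A.carrier]
    {n : ℕ} (φ : Formula σ n) : Continuous (φ.eval A) := by
  have hsnoc (n : ℕ) : Continuous fun p : (Fin n → A.carrier) × A.carrier =>
      (Fin.snoc p.1 p.2 : Fin (n + 1) → A.carrier) := by fun_prop
  induction φ with
  | dist t t' =>
    exact ((t.continuous_eval A).dist (t'.continuous_eval A)).subtype_mk _
  | pred P t =>
    exact (A.pred_obeys P).continuous.comp (continuous_pi fun i => (t i).continuous_eval A)
  | conn c φ ih => exact c.continuous.comp (continuous_pi ih)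
  | inf φ ih =>
    have := isCompact_univ.continuous_sInf (f := fun a b => φ.eval A (Fin.snoc a b))
      (ih.comp (hsnoc _))
    simp only [Set.image_univ] at this
    exact this
  | sup φ ih =>
    have := isCompact_univ.continuous_sSup (f := fun a b => φ.eval A (Fin.snoc a b))
      (ih.comp (hsnoc _))
    simp only [Set.image_univ] at this
    exact this

theorem Formula.exists_eval_eq_zero {A : MetricStructure.{u, v, w, x} σ}
    {B : MetricStructure.{u, v, w, y} σ} [CompactSpace B.carrier] (h : B.Models A.theory) {n : ℕ}
    (φ : Formula σ n) {a : Fin n → A.carrier} (ha : φ.eval A a = 0) : ∃ b, φ.eval B b = 0 := by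
  have hφ : φ.infClosure.value B = 0 := by
    rw [Sentence.value_eq_of_models h]
    exact le_antisymm ((Formula.infClosure_value_le A φ a).trans ha.le) bot_le
  -- The minimum below needs some tuple to exist; the value `0 < 1` provides one.
  obtain ⟨b₀, -⟩ := φ.exists_eval_lt B (r := 1) (hφ.trans_lt one_pos)
  obtain ⟨b, -, hb⟩ := isCompact_univ.exists_isMinOn ⟨b₀, Set.mem_univ _⟩
    (φ.continuous_eval B).continuousOn
  refine ⟨b, not_ne_iff.1 fun hne => ?_⟩
  obtain ⟨c, hc⟩ := φ.exists_eval_lt B (hφ.trans_lt (bot_lt_iff_ne_bot.2 hne))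
  exact hc.not_ge (hb (Set.mem_univ c))

/-! ### Compactness in the space of maps -/

/-- A tuple of elements of `A` together with a formula that vanishes at it. -/
structure ZeroCondition (A : MetricStructure.{u, v, w, x} σ) where
  n : ℕ
  a : Fin n → A.carrier
  φ : Formula σ n
  eval_eq_zero : φ.eval A a = 0

/-- The maps `A → B` that preserve a given condition. -/
def ZeroCondition.solutions {A : MetricStructure.{u, v, w, x} σ} (c : ZeroCondition A)
    (B : MetricStructure.{u, v, w, y} σ) : Set (A.carrier → B.carrier) :=
  {f | c.φ.eval B (f ∘ c.a) = 0}

theorem ZeroCondition.isClosed_solutions {A : MetricStructure.{u, v, w, x} σ}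
    (c : ZeroCondition A) (B : MetricStructure.{u, v, w, y} σ) [CompactSpace B.carrier] :
    IsClosed (c.solutions B) :=
  isClosed_singleton.preimage ((c.φ.continuous_eval B).comp
    (continuous_pi fun i => continuous_apply (c.a i)))

theorem append_comp_castAdd {X : Type*} {n m : ℕ} (a : Fin n → X) (b : Fin m → X) :
    Fin.append a b ∘ Fin.castAdd m = a :=
  funext (Fin.append_left a b)

theorem append_comp_natAdd {X : Type*} {n m : ℕ} (a : Fin n → X) (b : Fin m → X) :
    Fin.append a b ∘ Fin.natAdd n = b :=
  funext (Fin.append_right a b)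

/-- Two conditions combine into one: concatenate the tuples and take the maximum of the formulas in
disjoint variables. -/
theorem ZeroCondition.directed_solutions (A : MetricStructure.{u, v, w, x} σ)
    (B : MetricStructure.{u, v, w, y} σ) :
    Directed (· ⊇ ·) fun c : ZeroCondition A => c.solutions B := by
  intro c d
  refine ⟨⟨c.n + d.n, Fin.append c.a d.a,
    (c.φ.relabel (Fin.castAdd d.n)).max (d.φ.relabel (Fin.natAdd c.n)), ?_⟩, ?_, ?_⟩
  · rw [Formula.eval_max, Formula.eval_relabel, Formula.eval_relabel, append_comp_castAdd,
      append_comp_natAdd, c.eval_eq_zero, d.eval_eq_zero, sup_idem]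
  · intro f hf
    have h := (le_sup_left.trans (Formula.eval_max B _ _ _).ge).trans (le_of_eq hf)
    rw [Formula.eval_relabel, Function.comp_assoc, append_comp_castAdd] at h
    exact le_antisymm h bot_le
  · intro f hf
    have h := (le_sup_right.trans (Formula.eval_max B _ _ _).ge).trans (le_of_eq hf)
    rw [Formula.eval_relabel, Function.comp_assoc, append_comp_natAdd] at h
    exact le_antisymm h bot_le

theorem MetricStructure.nonempty_of_models {A : MetricStructure.{u, v, w, x} σ}
    {B : MetricStructure.{u, v, w, y} σ} [Nonempty A.carrier] (h : B.Models A.theory) :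
    Nonempty B.carrier := by
  have a : A.carrier := Classical.arbitrary _
  let φ : Formula σ 1 := .dist (.var 0) (.var 0)
  have hA : φ.eval A (fun _ => a) = 0 := Subtype.ext (dist_self a)
  have hB : φ.infClosure.value B < 1 := by
    rw [Sentence.value_eq_of_models h]
    exact ((φ.infClosure_value_le A _).trans hA.le).trans_lt one_pos
  obtain ⟨b, -⟩ := φ.exists_eval_lt B hB
  exact ⟨b 0⟩

theorem ZeroCondition.nonempty_solutions {A : MetricStructure.{u, v, w, x} σ}
    {B : MetricStructure.{u, v, w, y} σ} [CompactSpace B.carrier] (h : B.Models A.theory)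
    (c : ZeroCondition A) : (c.solutions B).Nonempty := by
  obtain ⟨j⟩ : Nonempty (A.carrier → B.carrier) := by
    cases isEmpty_or_nonempty A.carrier
    · exact ⟨isEmptyElim⟩
    · exact (MetricStructure.nonempty_of_models h).map fun b _ => b
  -- The tuple `c.a` may repeat entries, and a solution in `B` need not repeat them. Passing to an
  -- injective enumeration `a'` of its range makes any solution extend to a map, with `j` as filler.
  have := Fintype.ofFinite (Set.range c.a)
  let e := Fintype.equivFin (Set.range c.a)
  let a' : Fin (Fintype.card (Set.range c.a)) → A.carrier := fun i => e.symm i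
  let g : Fin c.n → Fin (Fintype.card (Set.range c.a)) := fun i => e ⟨c.a i, Set.mem_range_self i⟩
  have ha' : a'.Injective := Subtype.val_injective.comp e.symm.injective
  have hg : a' ∘ g = c.a := funext fun i => by simp [a', g]
  obtain ⟨b, hb⟩ := Formula.exists_eval_eq_zero h (c.φ.relabel g) (a := a') <| by
    rw [Formula.eval_relabel, hg, c.eval_eq_zero]
  refine ⟨Function.extend a' b j, ?_⟩
  rw [Formula.eval_relabel] at hb
  have hext : Function.extend a' b j ∘ c.a = b ∘ g :=
    (congrArg _ hg.symm).trans (congrArg (· ∘ g) (Function.extend_comp ha' b j))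
  exact (congrArg _ hext).trans hb

theorem MetricStructure.exists_elementary_map {A : MetricStructure.{u, v, w, x} σ}
    {B : MetricStructure.{u, v, w, y} σ} [CompactSpace B.carrier] (h : B.Models A.theory) :
    ∃ f : A.carrier → B.carrier, ∀ (n : ℕ) (φ : Formula σ n) (a : Fin n → A.carrier),
      φ.eval B (f ∘ a) = φ.eval A a := by
  have : Nonempty (ZeroCondition A) :=
    -- The nullary connective `0` gives a condition that always holds.
    ⟨⟨0, Fin.elim0, .conn (.const _ 0) Fin.elim0, rfl⟩⟩
  obtain ⟨f, hf⟩ := IsCompact.nonempty_iInter_of_directed_nonempty_isCompact_isClosed _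
    (ZeroCondition.directed_solutions A B) (ZeroCondition.nonempty_solutions h)
    (fun c => (c.isClosed_solutions B).isCompact) fun c => c.isClosed_solutions B
  refine ⟨f, fun n φ a => (Formula.eval_distTo_eq_zero B φ _ _).1 ?_⟩
  exact Set.mem_iInter.1 hf
    ⟨n, a, φ.distTo (φ.eval A a), (Formula.eval_distTo_eq_zero A φ _ _).2 rfl⟩

/-! ### The isomorphism -/

theorem MetricStructure.nonempty_iso_of_models {A : MetricStructure.{u, v, w, x} σ}
    [CompactSpace A.carrier] {B : MetricStructure.{u, v, w, y} σ} (h : B.Models A.theory) :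
    Nonempty (Iso A B) := by
  have := compactSpace_of_models h
  obtain ⟨f, hf⟩ := exists_elementary_map h
  have hiso : Isometry f := Isometry.of_dist_eq fun a a' =>
    congrArg Subtype.val (hf 2 (.dist (.var 0) (.var 1)) ![a, a'])
  have hdense : DenseRange f := Metric.dense_iff.2 fun b ε hε => by
    obtain ⟨r, hr, hr1, hrε⟩ := exists_unitInterval_lt hε
    obtain ⟨n, a, ha⟩ := A.exists_eval_covering_le hr hr1
    rw [← hf] at ha
    obtain ⟨i, hi⟩ := (eval_covering_le_iff B _ hr1).1 ha b
    exact ⟨f (a i), Metric.mem_ball.2 (hi.trans_lt hrε), Set.mem_range_self _⟩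
  have hsurj : f.Surjective := by
    rw [← Set.range_eq_univ, ← hiso.isClosedEmbedding.isClosed_range.closure_eq]
    exact hdense.closure_range
  refine ⟨⟨⟨Equiv.ofBijective f ⟨hiso.injective, hsurj⟩, hiso⟩, fun P a => ?_, fun F a => ?_,
    fun c => ?_⟩⟩
  · exact hf _ (.pred P .var) a
  -- The graph of `F` is the zero set of `d(F(v), vₙ)`; evaluate at `a` followed by `F(a)`.
  · have := congrArg Subtype.val (hf _ (.dist (.app F fun i => .var i.castSucc) (.var (Fin.last _)))
      (Fin.snoc a (A.func F a)))
    refine dist_eq_zero.1 (Eq.trans ?_ (this.trans ?_))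
    · simp [Formula.eval, Term.eval]
      rfl
    · simp [Formula.eval, Term.eval]
  · have := congrArg Subtype.val (hf 1 (.dist (.const c) (.var 0)) fun _ => A.const c)
    exact dist_eq_zero.1 (this.trans (dist_self _))

/-- The inverse of an isomorphism. -/
def Iso.symm {A : MetricStructure.{u, v, w, x} σ} {B : MetricStructure.{u, v, w, y} σ}
    (e : Iso A B) : Iso B A where
  toIsometryEquiv := e.toIsometryEquiv.symm
  map_pred P b := by simp [← e.map_pred]
  map_func f b := e.toIsometryEquiv.injective (by simp [← e.map_func])
  map_const c := by simp [e.map_const]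

/-- The composition of two isomorphisms. -/
def Iso.trans {A B C : MetricStructure.{u, v, w, x} σ} (e : Iso A B) (e' : Iso B C) :
    Iso A C where
  toIsometryEquiv := e.toIsometryEquiv.trans e'.toIsometryEquiv
  map_pred P a := by simp [e'.map_pred, e.map_pred]
  map_func f a := by simp [e'.map_func, e.map_func]
  map_const c := by simp [e'.map_const, e.map_const]

end ContLogic

theorem mainTheorem4 {σ : ContLogic.Signature.{u, v, w}}
    (A : ContLogic.MetricStructure.{u, v, w, x} σ) (hA : CompactSpace A.carrier) :
    ContLogic.Theory.IsCategorical.{u, v, w, x} A.theory ∧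
      ∀ B : ContLogic.MetricStructure.{u, v, w, y} σ,
        B.Models A.theory → Nonempty (ContLogic.Iso B A) := by
  refine ⟨⟨⟨A, fun φ hφ => hφ⟩, fun B C hB hC => ?_⟩, fun B hB => ?_⟩
  · obtain ⟨e⟩ := ContLogic.MetricStructure.nonempty_iso_of_models hB
    obtain ⟨e'⟩ := ContLogic.MetricStructure.nonempty_iso_of_models hC
    exact ⟨e.symm.trans e'⟩
  · exact (ContLogic.MetricStructure.nonempty_iso_of_models hB).map ContLogic.Iso.symm
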